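/- Let $\mathrm{St}(n,r)=\{X\in\mathbb{R}^{n\times r}: X^\top X=I_r\}$ be the Stiefel manifold $\mathcal{M}$, with tangent spaces $\mathrm{T}_X\mathcal{M}=\{V\in\mathbb{R}^{n\times r}: V^\top X+X^\top V=0\}$, where $\mathbb{R}^{n\times r}$ and the tangent spaces carry the inner product $\langle A,B\rangle=\mathrm{tr}(A^\top B)$ and its (Frobenius) norm $\|\cdot\|$. Let $\mathbf{R}:\mathrm{T}\mathcal{M}\to\mathcal{M}$ be a retraction, i.e. a smooth map such that its restriction $\mathbf{R}_X$ to $\mathrm{T}_X\mathcal{M}$ satisfies $\mathbf{R}_X(0)=X$ and $\mathrm{D}\mathbf{R}_X(0)=\mathrm{id}$ for every $X\in\mathcal{M}$, and let $M_2>0$ be a constant with $\|\mathbf{R}_X(\xi)-X-\xi\|\le M_2\|\xi\|^2$ for all $X\in\mathcal{M}$ and $\xi\in \mathrm{T}_X\mathcal{M}$. Let $f:\mathbb{R}^{n\times r}\to\mathbb{R}$ be twice continuously differentiable with Lipschitz continuous gradient $\nabla f$, let $h:\mathbb{R}^{n\times r}\to\mathbb{R}$ be convex and Lipschitz continuous with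 constant $L_h$ (and possibly nonsmooth), and put $F=f+h$. Fix $\sigma,\gamma\in(0,1)$ and an integer $m>0$. Let $X_0\in\mathcal{M}$ and let $\{X_k\}_{k\ge 0}$ be generated by the Riemannian proximal quasi-Newton method with nonmonotone line search: for every $k\ge0$, - $\mathcal{B}_k$ is a linear operator on $\mathbb{R}^{n\times r}$ that maps $\mathrm{T}_{X_k}\mathcal{M}$ into itself, is symmetric on $\mathrm{T}_{X_k}\mathcal{M}$, and satisfies $\kappa_1\|V\|^2\le\|V\|_{\mathcal{B}_k}^2\le\kappa_2\|V\|^2$ for all $V\in\mathrm{T}_{X_k}\mathcal{M}$, where $\|V\|_{\mathcal{B}_k}^2:=\langle V,\mathcal{B}_k[V]\rangle$ and $\kappa_1,\kappa_2>0$ do not depend on $k$; - $V_k$ is a minimizer over $V\in\mathrm{T}_{X_k}\mathcal{M}$ of $\langle\nabla f(X_k),V\rangle+\frac12\|V\|_{\mathcal{B}_k}^2+h(X_k+V)$; - $\alpha_k=\gamma^{N_k}$, where $N_k\ge 0$ is the smallest integer for which $$F(\mathbf{R}_{X_k}(\alpha_kV_k))\le\max_{\max\{0,k-m\}\le j\le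 k}F(X_j)-\tfrac12\sigma\alpha_k\|V_k\|_{\mathcal{B}_k}^2;$$ - $X_{k+1}=\mathbf{R}_{X_k}(\alpha_kV_k)$. Suppose that $\{X_k\}$ has an accumulation point $X^*$ such that $$\lambda_{\min}\big(\mathrm{Hess}(f\circ\mathbf{R}_{X^*})(0)\big)\ge\widetilde\eta\quad\text{for some }\widetilde\eta>5L_hM_2,$$ where $f\circ\mathbf{R}_{X^*}$ is regarded as a function on the Euclidean space $\mathrm{T}_{X^*}\mathcal{M}$. Then the whole sequence $X_k$ converges to $X^*$. -/

import Mathlib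

open Filter Topology
open scoped NNReal ContDiff Gradient

/-- The space `ℝ^{n×r}` of real `n × r` matrices, with the Frobenius norm and the inner product
`⟪A, B⟫ = tr(Aᵀ B)` (see `RMat.inner_eq_trace`). -/
abbrev RMat (n r : ℕ) : Type := EuclideanSpace ℝ (Fin n × Fin r)

/-- The matrix with the entries of `A`. -/
def RMat.mat {n r : ℕ} (A : RMat n r) : Matrix (Fin n) (Fin r) ℝ :=
  Matrix.of fun i j => A (i, j)

theorem RMat.inner_eq_trace {n r : ℕ} (A B : RMat n r) :
    inner ℝ A B = Matrix.trace (A.mat.transpose * B.mat) := by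
  simp only [PiLp.inner_apply, Matrix.trace, Matrix.diag, Matrix.mul_apply, RMat.mat,
    Matrix.transpose_apply, Matrix.of_apply, Fintype.sum_prod_type]
  rw [Finset.sum_comm]
  simp [mul_comm]

/-- The Stiefel manifold `St(n, r) = {X ∈ ℝ^{n×r} : Xᵀ X = I_r}`. -/
def stiefel (n r : ℕ) : Set (RMat n r) :=
  {X | X.mat.transpose * X.mat = 1}

/-- The tangent space `T_X St(n, r) = {V ∈ ℝ^{n×r} : Vᵀ X + Xᵀ V = 0}` at `X ∈ St(n, r)`, with the
inner product and the norm inherited from `ℝ^{n×r}`. -/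
def stiefelTangent {n r : ℕ} (X : RMat n r) : Submodule ℝ (RMat n r) where
  carrier := {V | V.mat.transpose * X.mat + X.mat.transpose * V.mat = 0}
  add_mem' := by
    intro V W hV hW
    have h : (V + W).mat = V.mat + W.mat := rfl
    simp only [Set.mem_ofPred_eq] at hV hW ⊢
    rw [h, Matrix.transpose_add, Matrix.add_mul, Matrix.mul_add, add_add_add_comm, hV, hW,
      add_zero]
  zero_mem' := by
    have h : (0 : RMat n r).mat = 0 := rfl
    simp [h]
  smul_mem' := by
    intro c V hV
    have h : (c • V).mat = c • V.mat := rfl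
    simp only [Set.mem_ofPred_eq] at hV ⊢
    rw [h, Matrix.transpose_smul, Matrix.smul_mul, Matrix.mul_smul, ← smul_add, hV, smul_zero]

/-- The tangent bundle `T St(n, r)`, as a subset (an embedded submanifold) of
`ℝ^{n×r} × ℝ^{n×r}`. -/
def stiefelTangentBundle (n r : ℕ) : Set (RMat n r × RMat n r) :=
  {p | p.1 ∈ stiefel n r ∧ p.2 ∈ stiefelTangent p.1}

/-- `R` is a retraction on the Stiefel manifold, `R X ξ` standing for `R_X(ξ)`: a smooth map from
the tangent bundle to the manifold with `R_X(0) = X` and `D R_X(0) = id` on `T_X St(n, r)`.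
The values of `R` off the tangent bundle play no role. -/
structure IsStiefelRetraction {n r : ℕ} (R : RMat n r → RMat n r → RMat n r) : Prop where
  smooth : ContDiffOn ℝ ∞ (fun p : RMat n r × RMat n r => R p.1 p.2) (stiefelTangentBundle n r)
  mapsTo : ∀ X ∈ stiefel n r, ∀ ξ ∈ stiefelTangent X, R X ξ ∈ stiefel n r
  map_zero : ∀ X ∈ stiefel n r, R X 0 = X
  hasFDerivAt_zero : ∀ X ∈ stiefel n r,
    HasFDerivAt (fun ξ : stiefelTangent X => R X ξ) (stiefelTangent X).subtypeL 0

/-- The Hessian operator of a real function on a Euclidean space: the derivative of its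
gradient. -/
noncomputable def hessian {E : Type*} [NormedAddCommGroup E] [InnerProductSpace ℝ E]
    [CompleteSpace E] (g : E → ℝ) (x : E) : E →L[ℝ] E :=
  fderiv ℝ (∇ g) x

/-- `λ_min(A) ≥ c`: every eigenvalue of the (self-adjoint) operator `A` is at least `c`. -/
def LambdaMinGE {E : Type*} [AddCommGroup E] [Module ℝ E] (A : E →ₗ[ℝ] E) (c : ℝ) : Prop :=
  ∀ μ : ℝ, Module.End.HasEigenvalue A μ → c ≤ μ

/-- The pullback `f ∘ R_X`, a real function on the tangent space at `X`. -/
def pullback {n r : ℕ} (R : RMat n r → RMat n r → RMat n r) (f : RMat n r → ℝ)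
    (X : RMat n r) : stiefelTangent X → ℝ :=
  fun ξ => f (R X ξ)

/-- The squared norm `‖V‖²_B = ⟪V, B[V]⟫`. -/
noncomputable def sqNorm {n r : ℕ} (B : RMat n r →ₗ[ℝ] RMat n r) (V : RMat n r) : ℝ :=
  inner ℝ V (B V)

/-- The objective `φ(V) = ⟪∇f(X), V⟫ + ½ ‖V‖²_B + h(X + V)` of the subproblem at `X`. -/
noncomputable def subproblemObj {n r : ℕ} (f h : RMat n r → ℝ) (X : RMat n r)
    (B : RMat n r →ₗ[ℝ] RMat n r) (V : RMat n r) : ℝ :=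
  inner ℝ (∇ f X) V + 1 / 2 * sqNorm B V + h (X + V)

/-- `max {F(X_j) : max{0, k - m} ≤ j ≤ k}` (the subtraction of naturals is truncated at `0`). -/
noncomputable def windowMax {E : Type*} (F : E → ℝ) (X : ℕ → E) (m k : ℕ) : ℝ :=
  (Finset.Icc (k - m) k).sup' (Finset.nonempty_Icc.2 (Nat.sub_le k m)) fun j => F (X j)

/-- The nonmonotone line search condition for the stepsize `α` at iteration `k`:
`F(R_{X_k}(α V_k)) ≤ max_{max{0,k-m} ≤ j ≤ k} F(X_j) - ½ σ α ‖V_k‖²_{B_k}`. -/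
def LineSearchCond {n r : ℕ} (R : RMat n r → RMat n r → RMat n r) (F : RMat n r → ℝ)
    (m : ℕ) (σ : ℝ) (X V : ℕ → RMat n r) (B : ℕ → RMat n r →ₗ[ℝ] RMat n r) (k : ℕ) (α : ℝ) :
    Prop :=
  F (R (X k) (α • V k)) ≤ windowMax F X m k - 1 / 2 * σ * α * sqNorm (B k) (V k)

/-- `X` is a sequence of iterates of the Riemannian proximal quasi-Newton method (ManPQN) for
`min {f(X) + h(X) : X ∈ St(n, r)}`, with quasi-Newton operators `B k`, search directions `V k` and
stepsizes `γ ^ N k`. The operators `B k` are operators on `ℝ^{n×r}` that map `T_{X_k} St(n, r)`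
to itself and are symmetric there. -/
structure IsManPQNSequence {n r : ℕ} (R : RMat n r → RMat n r → RMat n r) (f h : RMat n r → ℝ)
    (m : ℕ) (σ γ : ℝ) (X V : ℕ → RMat n r) (B : ℕ → RMat n r →ₗ[ℝ] RMat n r) (N : ℕ → ℕ) :
    Prop where
  /-- the initial point is feasible -/
  init : X 0 ∈ stiefel n r
  tangent_invariant : ∀ k, ∀ U ∈ stiefelTangent (X k), B k U ∈ stiefelTangent (X k)
  symmetric : ∀ k, ∀ U ∈ stiefelTangent (X k), ∀ W ∈ stiefelTangent (X k),
    inner ℝ (B k U) W = inner ℝ U (B k W)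
  /-- the search direction `V_k` solves the subproblem on the tangent space -/
  direction_mem : ∀ k, V k ∈ stiefelTangent (X k)
  direction_min : ∀ k,
    IsMinOn (subproblemObj f h (X k) (B k)) (stiefelTangent (X k) : Set (RMat n r)) (V k)
  /-- `N_k` is the smallest number of backtracking steps after which the line search accepts -/
  lineSearch : ∀ k,
    IsLeast {i : ℕ | LineSearchCond R (fun Y => f Y + h Y) m σ X V B k (γ ^ i)} (N k)
  /-- the update `X_{k+1} = R_{X_k}(α_k V_k)` with `α_k = γ ^ N_k` -/
  step : ∀ k, X (k + 1) = R (X k) (γ ^ N k • V k)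

/-! ### Nonmonotone descent -/

/-! The limit point is a strict local minimizer of `F = f + h` on the compact Stiefel manifold, and
a sequence with vanishing steps and convergent objective values cannot leave such a point.

Strictness: passing to the limit in the subproblems shows that `0` minimizes the first-order model
`⟪∇f, ξ⟫ + h(x + ξ)` on the tangent space at the limit `x` (`stationary_of_mapClusterPt`). The
Hessian bound makes `f ∘ R_x` exceed its linearization by `c/2 ‖ξ‖²` for any `c < η`, while
replacing `x + ξ` by `R_x(ξ)` costs `h` at most `Lh M₂ ‖ξ‖²`. So `c > 2 Lh M₂` is enough. Since
`R_x` covers a neighborhood of `x` in the manifold, the estimate reaches all nearby feasible points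
(`eventually_objective_lt_of_stationary`).

Dynamics: backtracking stops at stepsizes bounded below (`exists_le_stepsize`), so each iteration
gains a multiple of `‖V_k‖²` against the window maximum. The maxima decrease to a limit; uniform
continuity of `F` transfers this limit to the values themselves and forces `V_k → 0`
(`exists_tendsto_of_windowMax`, `asymptotics`). A trapping argument finishes
(`tendsto_of_mapClusterPt_of_strict_min`). -/

theorem le_windowMax {E : Type*} (F : E → ℝ) (X : ℕ → E) {m k j : ℕ} (h₁ : k - m ≤ j)
    (h₂ : j ≤ k) : F (X j) ≤ windowMax F X m k :=
  Finset.le_sup' (fun j => F (X j)) (Finset.mem_Icc.2 ⟨h₁, h₂⟩)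

theorem exists_eq_windowMax {E : Type*} (F : E → ℝ) (X : ℕ → E) (m k : ℕ) :
    ∃ j, k - m ≤ j ∧ j ≤ k ∧ windowMax F X m k = F (X j) := by
  obtain ⟨j, hj, h⟩ := Finset.exists_mem_eq_sup' (Finset.nonempty_Icc.2 (Nat.sub_le k m))
    fun j => F (X j)
  rw [Finset.mem_Icc] at hj
  exact ⟨j, hj.1, hj.2, h⟩

/-- Sliding the window adds only the value at `k + 1`, which the old maximum already dominates. -/
theorem windowMax_antitone {E : Type*} {F : E → ℝ} {X : ℕ → E} {m : ℕ}
    (hdesc : ∀ k, F (X (k + 1)) ≤ windowMax F X m k) : Antitone (windowMax F X m) := by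
  refine antitone_nat_of_succ_le fun k => ?_
  obtain ⟨j, hj₁, hj₂, hj⟩ := exists_eq_windowMax F X m (k + 1)
  rw [hj]
  rcases hj₂.lt_or_eq with h | rfl
  · exact le_windowMax F X (by omega) (by omega)
  · exact hdesc k

/-- If the objective values decrease by `d k` with respect to the maximum over a sliding window,
and small values of `d k` force small changes of the objective, then the objective values converge
and `d k` tends to zero. -/
theorem exists_tendsto_of_windowMax {E : Type*} {F : E → ℝ} {X : ℕ → E} {m : ℕ} {d : ℕ → ℝ}
    (hd : ∀ k, 0 ≤ d k) (hdesc : ∀ k, F (X (k + 1)) ≤ windowMax F X m k - d k)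
    (hbdd : BddBelow (Set.range fun k => F (X k)))
    (hcont : ∀ ε > 0, ∃ δ > 0, ∀ k, d k < δ → |F (X (k + 1)) - F (X k)| < ε) :
    ∃ w, Tendsto (fun k => F (X k)) atTop (𝓝 w) ∧ Tendsto d atTop (𝓝 0) := by
  have hanti : Antitone (windowMax F X m) :=
    windowMax_antitone fun k => (hdesc k).trans (sub_le_self _ (hd k))
  have hWbdd : BddBelow (Set.range (windowMax F X m)) := by
    obtain ⟨c, hc⟩ := hbdd
    refine ⟨c, ?_⟩
    rintro _ ⟨k, rfl⟩
    exact (hc ⟨k, rfl⟩).trans (le_windowMax F X (Nat.sub_le _ _) le_rfl)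
  set w := ⨅ k, windowMax F X m k with hw
  have hWw : Tendsto (windowMax F X m) atTop (𝓝 w) := tendsto_atTop_ciInf hanti hWbdd
  have hwle : ∀ k, w ≤ windowMax F X m k := fun k => ciInf_le hWbdd k
  -- Lower bounds near `w` propagate backwards: if the value at `k + j + 1` is close to `w`, it is
  -- close to the window maximum too, so `d (k + j)` is small and `hcont` makes the preceding value
  -- close to `w`.
  have back : ∀ j : ℕ, ∀ ε > 0, ∃ δ > 0, ∀ᶠ k in atTop, w - δ < F (X (k + j)) →
      w - ε < F (X k) := by
    intro j
    induction j with
    | zero => exact fun ε hε => ⟨ε, hε, Eventually.of_forall fun k h => h⟩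
    | succ j ih =>
      intro ε hε
      obtain ⟨δ, hδ, hj⟩ := ih ε hε
      obtain ⟨ρ, hρ, hstep⟩ := hcont (δ / 2) (half_pos hδ)
      refine ⟨min (δ / 2) (ρ / 2), lt_min (half_pos hδ) (half_pos hρ), ?_⟩
      have hW : ∀ᶠ k in atTop, windowMax F X m (k + j) < w + ρ / 2 :=
        (tendsto_add_atTop_iff_nat j).2 hWw |>.eventually (gt_mem_nhds (by linarith))
      filter_upwards [hj, hW] with k hk hWk h
      have h₁ := min_le_left (δ / 2) (ρ / 2)
      have h₂ := min_le_right (δ / 2) (ρ / 2)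
      have h₃ := hdesc (k + j)
      rw [← add_assoc] at h
      have h₄ := abs_lt.1 (hstep (k + j) (by linarith))
      exact hk (by linarith)
  have hF : Tendsto (fun k => F (X k)) atTop (𝓝 w) := by
    rw [tendsto_order]
    constructor
    · intro a ha
      -- The window maximum at `k + m` is at least `w` and is attained at some `k + j` with `j ≤ m`;
      -- only these finitely many `j` have to be traced back to `k`.
      have : ∀ᶠ k in atTop, ∀ j ∈ Finset.range (m + 1), w ≤ F (X (k + j)) → a < F (X k) := by
        refine (Filter.eventually_all_finset _).2 fun j _ => ?_
        obtain ⟨δ, hδ, h⟩ := back j (w - a) (by linarith)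
        filter_upwards [h] with k hk h'
        have := hk (by linarith)
        linarith
      filter_upwards [this] with k hk
      obtain ⟨j, hj₁, hj₂, hj⟩ := exists_eq_windowMax F X m (k + m)
      obtain ⟨i, rfl⟩ := Nat.exists_eq_add_of_le (show k ≤ j by omega)
      exact hk i (Finset.mem_range.2 (by omega)) (hj ▸ hwle _)
    · intro a ha
      filter_upwards [hWw.eventually (gt_mem_nhds ha)] with k hk
      exact (le_windowMax F X (Nat.sub_le _ _) le_rfl).trans_lt hk
  refine ⟨w, hF, ?_⟩
  have hlim := hWw.sub ((tendsto_add_atTop_iff_nat 1).2 hF)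
  rw [sub_self] at hlim
  exact squeeze_zero hd (fun k => by have := hdesc k; linarith) hlim

/-! ### Convergence to an isolated accumulation point -/

/-- A sequence in a compact set whose steps tend to zero, along which a continuous function
converges, converges to each of its accumulation points that is a strict local minimizer of this
function. -/
theorem tendsto_of_mapClusterPt_of_strict_min {E : Type*} [MetricSpace E] {K : Set E}
    (hK : IsCompact K) {F : E → ℝ} (hF : Continuous F) {X : ℕ → E} (hX : ∀ k, X k ∈ K)
    (hstep : Tendsto (fun k => dist (X (k + 1)) (X k)) atTop (𝓝 0)) {w : ℝ}
    (hw : Tendsto (fun k => F (X k)) atTop (𝓝 w)) {x : E} (hx : MapClusterPt x atTop X)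
    (hmin : ∀ᶠ y in 𝓝 x, y ∈ K → y ≠ x → F x < F y) : Tendsto X atTop (𝓝 x) := by
  have hFx : F x = w := by
    obtain ⟨φ, hφ, hXφ⟩ := hx.tendsto_subseq
    exact tendsto_nhds_unique ((hF.tendsto x).comp hXφ) (hw.comp hφ.tendsto_atTop)
  obtain ⟨δ, hδ, hball⟩ := Metric.eventually_nhds_iff.1 hmin
  rw [Metric.tendsto_atTop]
  intro ε hε
  set ρ := min ε δ / 2 with hρ_def
  have hρ : 0 < ρ := half_pos (lt_min hε hδ)
  have hρε : ρ < ε := by have := min_le_left ε δ; linarith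
  have hρδ : ρ < δ := by have := min_le_right ε δ; linarith
  -- The sequence eventually avoids this annulus, because the minimum of `F` there exceeds `w`.
  -- Steps shorter than its width `ρ / 2` cannot jump over it.
  have hcompact : IsCompact (K ∩ {y | ρ / 2 ≤ dist y x ∧ dist y x ≤ ρ}) :=
    hK.inter_right ((isClosed_le continuous_const (continuous_id.dist continuous_const)).inter
      (isClosed_le (continuous_id.dist continuous_const) continuous_const))
  have hannulus : ∀ᶠ k in atTop, X k ∉ K ∩ {y | ρ / 2 ≤ dist y x ∧ dist y x ≤ ρ} := by
    rcases (K ∩ {y | ρ / 2 ≤ dist y x ∧ dist y x ≤ ρ}).eq_empty_or_nonempty with he | hne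
    · simp [he]
    · obtain ⟨y, hy, hymin⟩ := hcompact.exists_isMinOn hne hF.continuousOn
      have hyx : y ≠ x := by
        rintro rfl
        have := hy.2.1
        rw [dist_self] at this
        linarith
      have hlt : w < F y := hFx ▸ hball (hy.2.2.trans_lt hρδ) hy.1 hyx
      filter_upwards [hw.eventually (gt_mem_nhds hlt)] with k hk hmem
      exact absurd (hymin hmem) (not_le.2 hk)
  obtain ⟨k₀, hk₀⟩ := eventually_atTop.1
    (hannulus.and (hstep.eventually (gt_mem_nhds (half_pos hρ))))
  obtain ⟨k₁, hk₁, hX₁⟩ := 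
    (hx.frequently (Metric.ball_mem_nhds x (half_pos hρ))).forall_exists_of_atTop k₀
  refine ⟨k₁, fun k hk => ?_⟩
  suffices dist (X k) x < ρ / 2 by linarith
  induction k, hk using Nat.le_induction with
  | base => exact hX₁
  | succ k hk ih =>
    have h₁ := (hk₀ k (hk₁.trans hk)).2
    have h₂ := (hk₀ (k + 1) (by omega)).1
    by_contra! hcon
    refine h₂ ⟨hX _, hcon, ?_⟩
    have := dist_triangle (X (k + 1)) (X k) x
    linarith

/-! ### Quadratic growth from the Hessian -/

section Growth

variable {E : Type*} [NormedAddCommGroup E] [InnerProductSpace ℝ E]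

theorem LambdaMinGE.mul_sq_norm_le [FiniteDimensional ℝ E] {A : E →ₗ[ℝ] E} (hA : A.IsSymmetric)
    {c : ℝ} (hc : LambdaMinGE A c) (x : E) : c * ‖x‖ ^ 2 ≤ inner ℝ (A x) x := by
  set b := hA.eigenvectorBasis rfl
  rw [← b.sum_inner_mul_inner, ← real_inner_self_eq_norm_sq x, ← b.sum_inner_mul_inner,
    Finset.mul_sum]
  refine Finset.sum_le_sum fun i _ => ?_
  rw [hA x, hA.apply_eigenvectorBasis, real_inner_smul_right, mul_assoc, real_inner_comm x]
  exact mul_le_mul_of_nonneg_right (hc _ (hA.hasEigenvalue_eigenvalues rfl i))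
    (mul_self_nonneg _)

theorem hasFDerivAt_hessian [CompleteSpace E] {g : E → ℝ} (hg : ContDiff ℝ 2 g) (x : E) :
    HasFDerivAt (∇ g) (hessian g x) x := by
  have h : ContDiff ℝ 1 (fderiv ℝ g) := hg.fderiv_right (by norm_num)
  have h' : Differentiable ℝ (∇ g) :=
    (InnerProductSpace.toDual ℝ E).symm.differentiable.comp (h.differentiable (by norm_num))
  exact (h' x).hasFDerivAt

/-- The function `y ↦ ⟪v, ∇g(y)⟫ = Dg(y) v` is differentiated in two ways. This reduces symmetry of
the Hessian operator to symmetry of the second derivative. -/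
theorem inner_hessian [CompleteSpace E] {g : E → ℝ} (hg : ContDiff ℝ 2 g) (x u v : E) :
    inner ℝ (hessian g x u) v = fderiv ℝ (fderiv ℝ g) x u v := by
  have h := (innerSL ℝ v).hasFDerivAt.comp x (hasFDerivAt_hessian hg x)
  have h₂ : HasFDerivAt (fderiv ℝ g) (fderiv ℝ (fderiv ℝ g) x) x :=
    ((hg.fderiv_right (m := 1) (by norm_num)).differentiable (by norm_num) x).hasFDerivAt
  have h₃ := (ContinuousLinearMap.apply ℝ ℝ v).hasFDerivAt.comp x h₂
  have heq : (⇑(innerSL ℝ v) ∘ ∇ g)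
      = (⇑(ContinuousLinearMap.apply ℝ ℝ v) ∘ fderiv ℝ g) := by
    funext y
    simp [inner_gradient_right]
  rw [heq] at h
  rw [real_inner_comm]
  simpa [innerSL_apply_apply] using congrArg (fun T : E →L[ℝ] ℝ => T u) (h.unique h₃)

theorem hessian_isSymmetric [CompleteSpace E] {g : E → ℝ} (hg : ContDiff ℝ 2 g) (x : E) :
    (hessian g x : E →ₗ[ℝ] E).IsSymmetric := by
  intro u v
  have hs : IsSymmSndFDerivAt ℝ g x :=
    hg.contDiffAt.isSymmSndFDerivAt (by simp)
  simp only [ContinuousLinearMap.coe_coe]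
  rw [real_inner_comm (hessian g x v), inner_hessian hg, inner_hessian hg, hs.eq]

theorem eventually_quadratic_growth [FiniteDimensional ℝ E] [CompleteSpace E] {g : E → ℝ}
    (hg : ContDiff ℝ 2 g) {η c : ℝ} (hη : LambdaMinGE (hessian g 0 : E →ₗ[ℝ] E) η) (hc : c < η) :
    ∀ᶠ ξ in 𝓝 (0 : E), g 0 + fderiv ℝ g 0 ξ + c / 2 * ‖ξ‖ ^ 2 ≤ g ξ := by
  have ho := (hasFDerivAt_iff_isLittleO_nhds_zero.1 (hasFDerivAt_hessian hg (0 : E))).def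
    (sub_pos.2 hc)
  obtain ⟨δ, hδ, hball⟩ := Metric.eventually_nhds_iff_ball.1 ho
  filter_upwards [Metric.ball_mem_nhds (0 : E) hδ] with ξ hξ
  have hdg : Differentiable ℝ g := hg.differentiable (by norm_num)
  -- The claim is `p 0 ≤ p 1`. The derivative of `p` is nonnegative since the error of linearizing
  -- `∇g` is at most `(η - c) t ‖ξ‖`, which the Hessian bound `η t ‖ξ‖²` absorbs after pairing with
  -- `ξ`.
  let p : ℝ → ℝ := fun t => g (t • ξ) - t * fderiv ℝ g 0 ξ - c / 2 * t ^ 2 * ‖ξ‖ ^ 2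
  have hp : ∀ t, HasDerivAt p (fderiv ℝ g (t • ξ) ξ - fderiv ℝ g 0 ξ - c * t * ‖ξ‖ ^ 2) t := by
    intro t
    have h₁ : HasDerivAt (fun t : ℝ => t • ξ) ξ t := by
      simpa using (hasDerivAt_id t).smul_const ξ
    have h₂ := (hdg (t • ξ)).hasFDerivAt.comp_hasDerivAt t h₁
    have h₃ := (hasDerivAt_id t).mul_const (fderiv ℝ g 0 ξ)
    have h₄ := (((hasDerivAt_pow 2 t).const_mul (c / 2)).mul_const (‖ξ‖ ^ 2))
    refine ((h₂.sub h₃).sub h₄).congr_deriv ?_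
    rw [show (2 - 1 : ℕ) = 1 from rfl]
    push_cast
    ring
  have hmono : MonotoneOn p (Set.Icc 0 1) := by
    refine monotoneOn_of_deriv_nonneg (convex_Icc 0 1)
      (fun t _ => (hp t).continuousAt.continuousWithinAt)
      (fun t _ => (hp t).differentiableAt.differentiableWithinAt) fun t ht => ?_
    rw [interior_Icc] at ht
    rw [(hp t).deriv]
    have hmem : t • ξ ∈ Metric.ball (0 : E) δ := by
      rw [mem_ball_zero_iff, norm_smul, Real.norm_of_nonneg ht.1.le] at *
      nlinarith [norm_nonneg ξ, ht.1, ht.2]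
    have h₁ := hball _ hmem
    rw [zero_add, norm_smul, Real.norm_of_nonneg ht.1.le, map_smul] at h₁
    have h₂ := hη.mul_sq_norm_le (hessian_isSymmetric hg 0) ξ
    simp only [ContinuousLinearMap.coe_coe] at h₂
    have h₃ := (abs_le.1 (abs_real_inner_le_norm (∇ g (t • ξ) - ∇ g 0 - t • hessian g 0 ξ) ξ)).1
    rw [inner_sub_left, inner_sub_left, real_inner_smul_left, inner_gradient_left,
      inner_gradient_left] at h₃
    have h₄ := mul_le_mul_of_nonneg_right h₁ (norm_nonneg ξ)
    have h₅ := mul_le_mul_of_nonneg_left h₂ ht.1.le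
    nlinarith
  have := hmono (Set.left_mem_Icc.2 zero_le_one) (Set.right_mem_Icc.2 zero_le_one) zero_le_one
  simp only [p, zero_smul, one_smul] at this
  linarith

/-- The first order Taylor estimate for a function with Lipschitz gradient. -/
theorem LipschitzWith.abs_sub_sub_inner_gradient_le [CompleteSpace E] {f : E → ℝ} {L : ℝ≥0}
    (hf : Differentiable ℝ f) (hL : LipschitzWith L (∇ f)) (x y : E) :
    |f y - f x - inner ℝ (∇ f x) (y - x)| ≤ L * ‖y - x‖ ^ 2 := by
  have hd : ∀ z ∈ Metric.closedBall x ‖y - x‖, HasFDerivWithinAt f (fderiv ℝ f z)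
      (Metric.closedBall x ‖y - x‖) z := fun z _ => (hf z).hasFDerivAt.hasFDerivWithinAt
  have hb : ∀ z ∈ Metric.closedBall x ‖y - x‖, ‖fderiv ℝ f z - fderiv ℝ f x‖ ≤ L * ‖y - x‖ := by
    intro z hz
    rw [← toDual_gradient, ← toDual_gradient, ← map_sub, LinearIsometryEquiv.norm_map,
      ← dist_eq_norm]
    exact (hL.dist_le_mul z x).trans (mul_le_mul_of_nonneg_left hz L.coe_nonneg)
  have := (convex_closedBall x ‖y - x‖).norm_image_sub_le_of_norm_hasFDerivWithin_le' hd hb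
    (Metric.mem_closedBall_self (norm_nonneg _)) (show y ∈ _ by simp [dist_eq_norm])
  rw [Real.norm_eq_abs, ← inner_gradient_left] at this
  rwa [sq, ← mul_assoc]

end Growth

/-! ### Geometry of the Stiefel manifold -/

section Geometry

open scoped Matrix.Norms.Frobenius

variable {n r : ℕ}

/-- Reading a vector of `RMat n r` as a matrix, as a linear map. -/
def RMat.matₗ (n r : ℕ) : RMat n r →ₗ[ℝ] Matrix (Fin n) (Fin r) ℝ where
  toFun := RMat.mat
  map_add' _ _ := rfl
  map_smul' _ _ := rfl

theorem RMat.mat_add (A B : RMat n r) : (A + B).mat = A.mat + B.mat := rfl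

theorem RMat.mat_sub (A B : RMat n r) : (A - B).mat = A.mat - B.mat := rfl

/-- The element of `RMat n r` with the entries of a matrix. -/
noncomputable def RMat.ofMat (A : Matrix (Fin n) (Fin r) ℝ) : RMat n r :=
  WithLp.toLp 2 fun p => A p.1 p.2

theorem RMat.mat_ofMat (A : Matrix (Fin n) (Fin r) ℝ) : (RMat.ofMat A).mat = A := rfl

theorem RMat.continuous_mat : Continuous (RMat.mat (n := n) (r := r)) :=
  (RMat.matₗ n r).continuous_of_finiteDimensional

theorem RMat.continuous_ofMat : Continuous (RMat.ofMat (n := n) (r := r)) :=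
  (PiLp.continuous_toLp 2 _).comp
    (continuous_pi fun p => (continuous_apply p.2).comp (continuous_apply p.1))

theorem RMat.norm_mat (A : RMat n r) : ‖A.mat‖ = ‖A‖ := by
  rw [Matrix.frobenius_norm_def, EuclideanSpace.norm_eq, Real.sqrt_eq_rpow,
    Fintype.sum_prod_type]
  simp [RMat.mat]

theorem mem_stiefel_iff {X : RMat n r} : X ∈ stiefel n r ↔ X.mat.transpose * X.mat = 1 :=
  Iff.rfl

theorem mem_stiefelTangent_iff {X V : RMat n r} :
    V ∈ stiefelTangent X ↔ V.mat.transpose * X.mat + X.mat.transpose * V.mat = 0 :=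
  Iff.rfl

theorem isCompact_stiefel (n r : ℕ) : IsCompact (stiefel n r) := by
  refine Metric.isCompact_of_isClosed_isBounded ?_ ?_
  · exact isClosed_eq (RMat.continuous_mat.matrix_transpose.matrix_mul RMat.continuous_mat)
      continuous_const
  · refine (Metric.isBounded_iff_subset_closedBall 0).2 ⟨√r, fun X hX => ?_⟩
    rw [mem_closedBall_zero_iff]
    refine Real.le_sqrt_of_sq_le (le_of_eq ?_)
    rw [← real_inner_self_eq_norm_sq, RMat.inner_eq_trace, mem_stiefel_iff.1 hX]
    simp

/-- The orthogonal projection of `Z` to the tangent space at a point `X` of the Stiefel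
manifold. -/
noncomputable def stiefelProj (X Z : RMat n r) : RMat n r :=
  Z - RMat.ofMat ((1 / 2 : ℝ) •
    (X.mat * (X.mat.transpose * Z.mat + Z.mat.transpose * X.mat)))

theorem stiefelProj_mem {X : RMat n r} (hX : X ∈ stiefel n r) (Z : RMat n r) :
    stiefelProj X Z ∈ stiefelTangent X := by
  rw [mem_stiefelTangent_iff, stiefelProj, RMat.mat_sub, RMat.mat_ofMat]
  simp only [Matrix.transpose_sub, Matrix.transpose_smul, Matrix.transpose_mul,
    Matrix.transpose_add, Matrix.transpose_transpose, Matrix.sub_mul, Matrix.mul_sub,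
    Matrix.smul_mul, Matrix.mul_smul]
  rw [Matrix.mul_assoc _ X.mat.transpose X.mat, ← Matrix.mul_assoc X.mat.transpose X.mat,
    mem_stiefel_iff.1 hX, Matrix.mul_one, Matrix.one_mul]
  module

theorem stiefelProj_eq_self {X V : RMat n r} (hV : V ∈ stiefelTangent X) :
    stiefelProj X V = V := by
  rw [mem_stiefelTangent_iff, add_comm] at hV
  rw [stiefelProj, hV]
  simp only [Matrix.mul_zero, smul_zero]
  exact sub_zero V

/-- Tangent spaces vary with the iterate. Projecting a fixed vector gives admissible test directions
that converge along a convergent subsequence. -/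
theorem continuous_stiefelProj (Z : RMat n r) : Continuous fun X => stiefelProj X Z := by
  have h := RMat.continuous_mat (n := n) (r := r)
  have h' : Continuous fun X : RMat n r => (1 / 2 : ℝ) •
      (X.mat * (X.mat.transpose * Z.mat + Z.mat.transpose * X.mat)) :=
    (h.matrix_mul ((h.matrix_transpose.matrix_mul continuous_const).add
      (continuous_const.matrix_mul h))).const_smul (1 / 2 : ℝ)
  exact continuous_const.sub (RMat.continuous_ofMat.comp h')

/-- Near `X`, a point of the Stiefel manifold is determined by its orthogonal projection to the
tangent space at `X`. -/
theorem exists_nhds_eq_of_sub_mem_orthogonal (X : RMat n r) :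
    ∃ U ∈ 𝓝 X, ∀ Y ∈ U, ∀ Z ∈ U, Y ∈ stiefel n r → Z ∈ stiefel n r →
      Y - Z ∈ (stiefelTangent X)ᗮ → Y = Z := by
  let A : RMat n r →ₗ[ℝ] Matrix (Fin r) (Fin r) ℝ :=
    { toFun := fun D => D.mat.transpose * X.mat + X.mat.transpose * D.mat
      map_add' := fun D D' => by
        simp only [RMat.mat_add, Matrix.transpose_add, Matrix.add_mul, Matrix.mul_add]
        abel
      map_smul' := fun c D => by
        have h : (c • D).mat = c • D.mat := rfl
        simp [h] }
  -- The kernel of `A` is the tangent space, so `A` is injective, hence bounded below, on the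
  -- orthogonal complement.
  have hker : LinearMap.ker (A.domRestrict (stiefelTangent X)ᗮ) = ⊥ := by
    rw [LinearMap.ker_eq_bot']
    rintro ⟨D, hD⟩ h
    have hT : D ∈ stiefelTangent X := h
    have := (Submodule.isOrtho_iff_inner_eq.1 (stiefelTangent X).isOrtho_orthogonal_right) D hT D hD
    simpa using this
  obtain ⟨K, hK, hanti⟩ := LinearMap.exists_antilipschitzWith _ hker
  have hK' : (0 : ℝ) < K := hK
  -- With this radius `K * (‖Y - X‖ + ‖Z - X‖) < 1`, so `‖D‖ ≤ K * ‖A D‖` forces `D = 0`.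
  refine ⟨Metric.ball X (1 / (2 * K)), Metric.ball_mem_nhds _ (by positivity), ?_⟩
  intro Y hY Z hZ hYs hZs hYZ
  rw [Metric.mem_ball, dist_eq_norm, lt_div_iff₀ (by positivity)] at hY hZ
  set D := Y - Z with hD
  have hle : ‖D‖ ≤ K * ‖A D‖ := by
    simpa using hanti.le_mul_norm_sub ⟨D, hYZ⟩ 0
  -- Subtracting the constraints gives `Dᵀ Y + Zᵀ D = 0`; thus `A D` is quadratically small.
  have hAD : A D = -(D.mat.transpose * (Y - X).mat + (Z - X).mat.transpose * D.mat) := by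
    change D.mat.transpose * X.mat + X.mat.transpose * D.mat = _
    rw [eq_neg_iff_add_eq_zero]
    have h : Y.mat.transpose * Y.mat - Z.mat.transpose * Z.mat = 0 := by
      rw [mem_stiefel_iff.1 hYs, mem_stiefel_iff.1 hZs, sub_self]
    rw [← h]
    simp only [hD, RMat.mat_sub, Matrix.transpose_sub, Matrix.sub_mul, Matrix.mul_sub]
    abel
  have hbound : ‖A D‖ ≤ ‖D‖ * (‖Y - X‖ + ‖Z - X‖) := by
    rw [hAD, norm_neg]
    refine (norm_add_le _ _).trans ?_
    have h₁ := Matrix.frobenius_norm_mul D.mat.transpose (Y - X).mat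
    have h₂ := Matrix.frobenius_norm_mul (Z - X).mat.transpose D.mat
    rw [Matrix.frobenius_norm_transpose, RMat.norm_mat, RMat.norm_mat] at h₁ h₂
    linarith
  have hD0 : ‖D‖ ≤ 0 := by
    by_contra! hpos
    have h₁ := hle.trans (mul_le_mul_of_nonneg_left hbound hK'.le)
    nlinarith
  exact sub_eq_zero.1 (norm_le_zero_iff.1 hD0)

end Geometry

namespace IsStiefelRetraction

variable {n r : ℕ} {R : RMat n r → RMat n r → RMat n r}

theorem contDiff (hR : IsStiefelRetraction R) {X : RMat n r} (hX : X ∈ stiefel n r) :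
    ContDiff ℝ ∞ fun ξ : stiefelTangent X => R X ξ := by
  rw [← contDiffOn_univ]
  have h : ContDiffOn ℝ ∞ (fun ξ : stiefelTangent X => (X, (ξ : RMat n r))) Set.univ :=
    (contDiff_const.prodMk (stiefelTangent X).subtypeL.contDiff).contDiffOn
  exact hR.smooth.comp h fun ξ _ => ⟨hX, ξ.2⟩

/-- A retraction covers a neighborhood of its base point in the Stiefel manifold. -/
theorem eventually_exists_eq (hR : IsStiefelRetraction R) {X : RMat n r} (hX : X ∈ stiefel n r)
    {U : Set (stiefelTangent X)} (hU : U ∈ 𝓝 0) :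
    ∀ᶠ Y in 𝓝 X, Y ∈ stiefel n r → ∃ ξ ∈ U, R X ξ = Y := by
  obtain ⟨W, hW, hinj⟩ := exists_nhds_eq_of_sub_mem_orthogonal X
  set P := (stiefelTangent X).orthogonalProjectionOnto with hP
  -- In tangential coordinates the retraction has derivative the identity, so the inverse function
  -- theorem applies. Equality of projections is then lifted to equality of points by `hinj`.
  have hd : HasFDerivAt (fun ξ : stiefelTangent X => P (R X ξ))
      ((ContinuousLinearEquiv.refl ℝ (stiefelTangent X) :
        stiefelTangent X ≃L[ℝ] stiefelTangent X) : stiefelTangent X →L[ℝ] stiefelTangent X) 0 := by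
    refine (P.hasFDerivAt.comp (0 : stiefelTangent X)
      (hR.hasFDerivAt_zero X hX)).congr_fderiv ?_
    ext ξ
    simp [hP]
  have hs := (P.contDiff.comp (hR.contDiff hX)).contDiffAt.hasStrictFDerivAt' hd (by simp)
  have hcont : ContinuousAt (fun ξ : stiefelTangent X => R X ξ) 0 :=
    (hR.contDiff hX).continuous.continuousAt
  have hzero : R X (0 : stiefelTangent X) = X := hR.map_zero X hX
  have hW' : (fun ξ : stiefelTangent X => R X ξ) ⁻¹' W ∈ 𝓝 0 :=
    hcont.preimage_mem_nhds (by rwa [hzero])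
  have himage := image_mem_map (m := P ∘ fun ξ : stiefelTangent X => R X ξ) (inter_mem hU hW')
  rw [hs.map_nhds_eq_of_equiv, Function.comp_apply, hzero] at himage
  filter_upwards [P.continuous.continuousAt.preimage_mem_nhds himage, hW] with Y hY hYW hYs
  obtain ⟨ξ, ⟨hξU, hξW⟩, hξ⟩ := hY
  refine ⟨ξ, hξU, hinj _ hξW _ hYW (hR.mapsTo X hX ξ ξ.2) hYs ?_⟩
  rw [← Submodule.orthogonalProjectionOnto_eq_zero_iff, map_sub, sub_eq_zero]
  exact hξ

end IsStiefelRetraction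

/-! ### The proximal quasi-Newton iteration -/

section Iteration

variable {n r : ℕ}

theorem sqNorm_smul (B : RMat n r →ₗ[ℝ] RMat n r) (t : ℝ) (V : RMat n r) :
    sqNorm B (t • V) = t ^ 2 * sqNorm B V := by
  simp only [sqNorm, map_smul, real_inner_smul_left, real_inner_smul_right]
  ring

/-- The predicted first order decrease along a minimizer of the subproblem. -/
theorem inner_gradient_add_le_neg_sqNorm {f h : RMat n r → ℝ} (hh : ConvexOn ℝ Set.univ h)
    {X V : RMat n r} {B : RMat n r →ₗ[ℝ] RMat n r} (hV : V ∈ stiefelTangent X)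
    (hmin : IsMinOn (subproblemObj f h X B) (stiefelTangent X : Set (RMat n r)) V) :
    inner ℝ (∇ f X) V + h (X + V) - h X ≤ -sqNorm B V := by
  -- Compare `V` with `t • V`, use convexity of `h`, and divide by `1 - t`. Letting `t → 1` gives
  -- the full factor `1` in front of `sqNorm B V`.
  have key : ∀ t ∈ Set.Ioo (0 : ℝ) 1,
      inner ℝ (∇ f X) V + h (X + V) - h X ≤ -(1 / 2 * (1 + t) * sqNorm B V) := by
    intro t ht
    have h₁ := isMinOn_iff.1 hmin (t • V) ((stiefelTangent X).smul_mem t hV)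
    have h₂ := hh.2 (Set.mem_univ X) (Set.mem_univ (X + V)) (sub_nonneg.2 ht.2.le) ht.1.le
      (sub_add_cancel _ _)
    rw [show (1 - t) • X + t • (X + V) = X + t • V by module, smul_eq_mul, smul_eq_mul] at h₂
    simp only [subproblemObj, sqNorm_smul, real_inner_smul_right] at h₁
    refine le_of_mul_le_mul_left ?_ (sub_pos.2 ht.2)
    nlinarith
  have hlim : Tendsto (fun t : ℝ => -(1 / 2 * (1 + t) * sqNorm B V)) (𝓝[<] 1)
      (𝓝 (-(1 / 2 * (1 + 1) * sqNorm B V))) :=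
    (Continuous.tendsto (by fun_prop) 1).mono_left nhdsWithin_le_nhds
  have h' := ge_of_tendsto hlim
    (by filter_upwards [Ioo_mem_nhdsLT (zero_lt_one' ℝ)] with t ht using key t ht)
  linarith

theorem norm_retraction_sub_le {R : RMat n r → RMat n r → RMat n r} {M₂ C : ℝ} (hM₂ : 0 ≤ M₂)
    {X ξ : RMat n r} (hR : ‖R X ξ - X - ξ‖ ≤ M₂ * ‖ξ‖ ^ 2) (hξ : ‖ξ‖ ≤ C) :
    ‖R X ξ - X‖ ≤ (1 + M₂ * C) * ‖ξ‖ := by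
  have h₁ : ‖R X ξ - X‖ ≤ ‖R X ξ - X - ξ‖ + ‖ξ‖ := by
    simpa using norm_add_le (R X ξ - X - ξ) ξ
  have h₂ : M₂ * ‖ξ‖ ^ 2 ≤ M₂ * C * ‖ξ‖ := by
    rw [sq, mul_assoc]
    gcongr
  linarith

theorem LipschitzWith.abs_sub_le {E : Type*} [NormedAddCommGroup E] {h : E → ℝ} {K : ℝ≥0}
    (hh : LipschitzWith K h) (x y : E) : |h x - h y| ≤ K * ‖x - y‖ := by
  simpa [dist_eq_norm] using hh.dist_le_mul x y

/-- The decrease of the objective along a retracted step. -/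
theorem objective_retraction_le {R : RMat n r → RMat n r → RMat n r} {M₂ C G : ℝ}
    (hM₂ : 0 ≤ M₂) {f h : RMat n r → ℝ} {L Lh : ℝ≥0} (hf : Differentiable ℝ f)
    (hfL : LipschitzWith L (∇ f)) (hh : ConvexOn ℝ Set.univ h) (hhL : LipschitzWith Lh h)
    {X V : RMat n r} {B : RMat n r →ₗ[ℝ] RMat n r} (hV : V ∈ stiefelTangent X)
    (hmin : IsMinOn (subproblemObj f h X B) (stiefelTangent X : Set (RMat n r)) V)
    (hG : ‖∇ f X‖ ≤ G) (hC : ‖V‖ ≤ C) {α : ℝ} (hα₀ : 0 ≤ α) (hα₁ : α ≤ 1)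
    (hR : ‖R X (α • V) - X - α • V‖ ≤ M₂ * ‖α • V‖ ^ 2) :
    f (R X (α • V)) + h (R X (α • V)) ≤ f X + h X - α * sqNorm B V
      + (G * M₂ + L * (1 + M₂ * C) ^ 2 + Lh * M₂) * α ^ 2 * ‖V‖ ^ 2 := by
  have hnorm : ‖α • V‖ = α * ‖V‖ := by rw [norm_smul, Real.norm_of_nonneg hα₀]
  have hξC : ‖α • V‖ ≤ C := by
    rw [hnorm]
    nlinarith [norm_nonneg V]
  have h₁ := norm_retraction_sub_le hM₂ hR hξC
  have h₂ := (abs_le.1 (hfL.abs_sub_sub_inner_gradient_le hf X (R X (α • V)))).2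
  have h₃ : inner ℝ (∇ f X) (R X (α • V) - X) ≤
      α * inner ℝ (∇ f X) V + G * (M₂ * ‖α • V‖ ^ 2) := by
    have h₃' : inner ℝ (∇ f X) (R X (α • V) - X) =
        inner ℝ (∇ f X) (R X (α • V) - X - α • V) + α * inner ℝ (∇ f X) V := by
      rw [inner_sub_right _ _ (α • V), real_inner_smul_right]
      ring
    have h₃'' := (real_inner_le_norm (∇ f X) (R X (α • V) - X - α • V)).trans
      (mul_le_mul hG hR (norm_nonneg _) ((norm_nonneg _).trans hG))
    linarith
  have h₄ : L * ‖R X (α • V) - X‖ ^ 2 ≤ L * ((1 + M₂ * C) * ‖α • V‖) ^ 2 := by gcongr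
  have h₅ : h (R X (α • V)) ≤ h (X + α • V) + Lh * (M₂ * ‖α • V‖ ^ 2) := by
    have h₅' := (abs_le.1 (hhL.abs_sub_le (R X (α • V)) (X + α • V))).2
    rw [← sub_sub] at h₅'
    have := mul_le_mul_of_nonneg_left hR Lh.coe_nonneg
    linarith
  have h₆ := hh.2 (Set.mem_univ X) (Set.mem_univ (X + V)) (sub_nonneg.2 hα₁) hα₀
    (sub_add_cancel _ _)
  rw [show (1 - α) • X + α • (X + V) = X + α • V by module, smul_eq_mul, smul_eq_mul] at h₆
  have h₇ := mul_le_mul_of_nonneg_left (inner_gradient_add_le_neg_sqNorm hh hV hmin) hα₀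
  rw [hnorm] at h₃ h₄ h₅
  nlinarith

namespace IsManPQNSequence

variable {R : RMat n r → RMat n r → RMat n r} {f h : RMat n r → ℝ} {m : ℕ} {σ γ : ℝ}
  {X V : ℕ → RMat n r} {B : ℕ → RMat n r →ₗ[ℝ] RMat n r} {N : ℕ → ℕ}

theorem mem_stiefel (hX : IsManPQNSequence R f h m σ γ X V B N)
    (hR : IsStiefelRetraction R) (k : ℕ) : X k ∈ stiefel n r := by
  induction k with
  | zero => exact hX.init
  | succ k ih =>
    rw [hX.step]
    exact hR.mapsTo _ ih _ ((stiefelTangent (X k)).smul_mem _ (hX.direction_mem k))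

/-- The predicted decrease gives `κ₁ ‖V‖² ≤ -⟪∇f, V⟫ - (h(X + V) - h(X)) ≤ (G + Lh) ‖V‖`. -/
theorem exists_norm_direction_le (hX : IsManPQNSequence R f h m σ γ X V B N)
    {Lh : ℝ≥0} (hh : ConvexOn ℝ Set.univ h) (hhL : LipschitzWith Lh h) {κ₁ G : ℝ} (hκ₁ : 0 < κ₁)
    (hB : ∀ k, ∀ U ∈ stiefelTangent (X k), κ₁ * ‖U‖ ^ 2 ≤ sqNorm (B k) U)
    (hG : ∀ k, ‖∇ f (X k)‖ ≤ G) : ∀ k, ‖V k‖ ≤ (G + Lh) / κ₁ := by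
  intro k
  have h₁ := inner_gradient_add_le_neg_sqNorm hh (hX.direction_mem k) (hX.direction_min k)
  have h₂ := hB k _ (hX.direction_mem k)
  have h₃ := (abs_le.1 ((abs_real_inner_le_norm (∇ f (X k)) (V k)).trans
    (mul_le_mul_of_nonneg_right (hG k) (norm_nonneg _)))).1
  have h₄ := (abs_le.1 (hhL.abs_sub_le (X k + V k) (X k))).1
  rw [add_sub_cancel_left] at h₄
  rw [le_div_iff₀ hκ₁]
  rcases (norm_nonneg (V k)).eq_or_lt with h0 | hpos
  · rw [← h0, zero_mul]
    exact add_nonneg ((norm_nonneg _).trans (hG k)) Lh.coe_nonneg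
  · refine le_of_mul_le_mul_right ?_ hpos
    nlinarith

/-- The stepsizes accepted by the line search are bounded away from zero. -/
theorem exists_le_stepsize (hX : IsManPQNSequence R f h m σ γ X V B N)
    (hR : IsStiefelRetraction R) {M₂ : ℝ} (hM₂ : 0 ≤ M₂)
    (hRM₂ : ∀ X ∈ stiefel n r, ∀ ξ ∈ stiefelTangent X, ‖R X ξ - X - ξ‖ ≤ M₂ * ‖ξ‖ ^ 2)
    {L Lh : ℝ≥0} (hf : Differentiable ℝ f) (hfL : LipschitzWith L (∇ f))
    (hh : ConvexOn ℝ Set.univ h) (hhL : LipschitzWith Lh h)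
    (hσ : σ < 1) (hγ : γ ∈ Set.Ioo (0 : ℝ) 1) {κ₁ G C : ℝ} (hκ₁ : 0 < κ₁)
    (hB : ∀ k, ∀ U ∈ stiefelTangent (X k), κ₁ * ‖U‖ ^ 2 ≤ sqNorm (B k) U)
    (hG : ∀ k, ‖∇ f (X k)‖ ≤ G) (hC : ∀ k, ‖V k‖ ≤ C) :
    ∃ a > 0, ∀ k, a ≤ γ ^ N k := by
  have hG₀ : 0 ≤ G := (norm_nonneg _).trans (hG 0)
  set D : ℝ := G * M₂ + L * (1 + M₂ * C) ^ 2 + Lh * M₂ with hD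
  have hD₀ : 0 ≤ D := by positivity
  have hs : 0 < (1 - σ / 2) * κ₁ := mul_pos (by linarith) hκ₁
  -- Any trial stepsize up to `a₀` is accepted, since its quadratic error is at most `(1 - σ / 2)`
  -- times the predicted decrease. The last rejected one therefore exceeds `a₀`, and one more factor
  -- `γ` gives the bound. The `+ 1` keeps the denominator positive.
  set a₀ : ℝ := (1 - σ / 2) * κ₁ / (D + 1) with ha₀_def
  have ha₀ : 0 < a₀ := div_pos hs (by positivity)
  refine ⟨min 1 (a₀ * γ), lt_min one_pos (mul_pos ha₀ hγ.1), fun k => ?_⟩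
  rcases hN : N k with _ | i
  · simp
  refine (min_le_right _ _).trans ?_
  rw [pow_succ]
  refine mul_le_mul_of_nonneg_right ?_ hγ.1.le
  by_contra! hlt
  have hle : N k ≤ i := by
    refine (hX.lineSearch k).2 ?_
    have hi₀ : 0 < γ ^ i := pow_pos hγ.1 i
    have hmem := hX.mem_stiefel hR k
    have h₁ := objective_retraction_le (R := R) hM₂ hf hfL hh hhL (hX.direction_mem k)
      (hX.direction_min k) (hG k) (hC k) hi₀.le (pow_le_one₀ hγ.1.le hγ.2.le)
      (hRM₂ _ hmem _ ((stiefelTangent (X k)).smul_mem _ (hX.direction_mem k)))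
    rw [← hD] at h₁
    have h₂ : D * γ ^ i ≤ (1 - σ / 2) * κ₁ := by
      rw [ha₀_def, lt_div_iff₀ (by positivity)] at hlt
      nlinarith
    have h₃ := hB k _ (hX.direction_mem k)
    have h₄ : D * γ ^ i * ‖V k‖ ^ 2 ≤ (1 - σ / 2) * sqNorm (B k) (V k) := by
      refine (mul_le_mul_of_nonneg_right h₂ (sq_nonneg _)).trans ?_
      rw [mul_assoc]
      exact mul_le_mul_of_nonneg_left h₃ (by linarith)
    have h₅ := mul_le_mul_of_nonneg_left h₄ hi₀.le
    have h₆ := le_windowMax (fun Y => f Y + h Y) X (Nat.sub_le k m) le_rfl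
    simp only [Set.mem_ofPred_eq, LineSearchCond]
    nlinarith
  omega

/-- The objective values converge, and the search directions and the steps tend to zero. -/
theorem asymptotics (hX : IsManPQNSequence R f h m σ γ X V B N)
    (hR : IsStiefelRetraction R) {M₂ : ℝ} (hM₂ : 0 ≤ M₂)
    (hRM₂ : ∀ X ∈ stiefel n r, ∀ ξ ∈ stiefelTangent X, ‖R X ξ - X - ξ‖ ≤ M₂ * ‖ξ‖ ^ 2)
    {L Lh : ℝ≥0} (hf : Differentiable ℝ f) (hfL : LipschitzWith L (∇ f))
    (hh : ConvexOn ℝ Set.univ h) (hhL : LipschitzWith Lh h)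
    (hσ : σ ∈ Set.Ioo (0 : ℝ) 1) (hγ : γ ∈ Set.Ioo (0 : ℝ) 1) {κ₁ : ℝ} (hκ₁ : 0 < κ₁)
    (hB : ∀ k, ∀ U ∈ stiefelTangent (X k), κ₁ * ‖U‖ ^ 2 ≤ sqNorm (B k) U) :
    (∃ w, Tendsto (fun k => f (X k) + h (X k)) atTop (𝓝 w)) ∧ Tendsto V atTop (𝓝 0) ∧
      Tendsto (fun k => dist (X (k + 1)) (X k)) atTop (𝓝 0) := by
  have hmem := hX.mem_stiefel hR
  obtain ⟨G, hG⟩ := (isCompact_stiefel n r).exists_bound_of_continuousOn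
    hfL.continuous.continuousOn
  have hG' : ∀ k, ‖∇ f (X k)‖ ≤ G := fun k => hG _ (hmem k)
  have hC := hX.exists_norm_direction_le hh hhL hκ₁ hB hG'
  set C := (G + Lh) / κ₁
  have hC₀ : 0 ≤ C := (norm_nonneg _).trans (hC 0)
  obtain ⟨a, ha, hstep⟩ := hX.exists_le_stepsize hR hM₂ hRM₂ hf hfL hh hhL hσ.2 hγ hκ₁ hB hG' hC
  have hFc : Continuous fun Y => f Y + h Y := hf.continuous.add hhL.continuous
  have hdist : ∀ k, dist (X (k + 1)) (X k) ≤ (1 + M₂ * C) * ‖V k‖ := by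
    intro k
    have hα₀ : 0 ≤ γ ^ N k := pow_nonneg hγ.1.le _
    have hα : ‖γ ^ N k • V k‖ ≤ ‖V k‖ := by
      rw [norm_smul, Real.norm_of_nonneg hα₀]
      exact mul_le_of_le_one_left (norm_nonneg _) (pow_le_one₀ hγ.1.le hγ.2.le)
    rw [hX.step, dist_eq_norm]
    exact (norm_retraction_sub_le hM₂ (hRM₂ _ (hmem k) _
      ((stiefelTangent (X k)).smul_mem _ (hX.direction_mem k))) (hα.trans (hC k))).trans
      (mul_le_mul_of_nonneg_left hα (by positivity))
  have hdlow : ∀ k, 1 / 2 * σ * a * κ₁ * ‖V k‖ ^ 2 ≤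
      1 / 2 * σ * γ ^ N k * sqNorm (B k) (V k) := by
    intro k
    have h₁ := hB k _ (hX.direction_mem k)
    have h₂ : 1 / 2 * σ * a ≤ 1 / 2 * σ * γ ^ N k :=
      mul_le_mul_of_nonneg_left (hstep k) (by have := hσ.1; positivity)
    have h₃ : 0 ≤ 1 / 2 * σ * γ ^ N k := mul_nonneg (by have := hσ.1; positivity)
      (pow_nonneg hγ.1.le _)
    rw [mul_assoc _ κ₁]
    exact mul_le_mul h₂ h₁ (by positivity) h₃
  have hb : 0 < 1 / 2 * σ * a * κ₁ := by have := hσ.1; positivity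
  set b := 1 / 2 * σ * a * κ₁
  obtain ⟨w, hw, hd⟩ := exists_tendsto_of_windowMax (F := fun Y => f Y + h Y) (X := X) (m := m)
    (d := fun k => 1 / 2 * σ * γ ^ N k * sqNorm (B k) (V k))
    (fun k => (by positivity : 0 ≤ b * ‖V k‖ ^ 2).trans (hdlow k))
    (fun k => by rw [hX.step]; exact (hX.lineSearch k).1)
    ((((isCompact_stiefel n r).image hFc).bddBelow).mono (by
      rintro _ ⟨k, rfl⟩
      exact ⟨X k, hmem k, rfl⟩))
    (by
      intro ε hε
      obtain ⟨ρ, hρ, hu⟩ := Metric.uniformContinuousOn_iff.1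
        ((isCompact_stiefel n r).uniformContinuousOn_of_continuous hFc.continuousOn) ε hε
      have hc : 0 < 1 + M₂ * C := by positivity
      -- Below this threshold `‖V k‖ < ρ / (1 + M₂ * C)`, so the step is shorter than the modulus
      -- `ρ` of uniform continuity.
      refine ⟨b * (ρ / (1 + M₂ * C)) ^ 2, by positivity, fun k hk => ?_⟩
      have h₁ := lt_of_mul_lt_mul_left ((hdlow k).trans_lt hk) hb.le
      have h₂ := lt_of_pow_lt_pow_left₀ 2 (by positivity) h₁
      rw [lt_div_iff₀ hc, mul_comm] at h₂
      exact hu _ (hmem _) _ (hmem _) ((hdist k).trans_lt h₂))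
  have hV : Tendsto (fun k => ‖V k‖) atTop (𝓝 0) := by
    have h₁ : Tendsto (fun k => ‖V k‖ ^ 2) atTop (𝓝 0) := by
      have hd' := hd.div_const b
      rw [zero_div] at hd'
      refine squeeze_zero (fun k => by positivity) (fun k => ?_) hd'
      rw [le_div_iff₀ hb, mul_comm]
      exact hdlow k
    simpa [Real.sqrt_sq] using h₁.sqrt
  refine ⟨⟨w, hw⟩, tendsto_zero_iff_norm_tendsto_zero.2 hV, ?_⟩
  refine squeeze_zero (fun _ => dist_nonneg) hdist ?_
  simpa using hV.const_mul (1 + M₂ * C)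

/-- Accumulation points of the iterates are stationary if the search directions tend to zero. -/
theorem stationary_of_mapClusterPt (hX : IsManPQNSequence R f h m σ γ X V B N)
    (hmem : ∀ k, X k ∈ stiefel n r) (hf : Continuous (∇ f))
    (hh : ConvexOn ℝ Set.univ h) (hhc : Continuous h) {κ₂ : ℝ}
    (hB₀ : ∀ k, ∀ U ∈ stiefelTangent (X k), 0 ≤ sqNorm (B k) U)
    (hB : ∀ k, ∀ U ∈ stiefelTangent (X k), sqNorm (B k) U ≤ κ₂ * ‖U‖ ^ 2)
    (hV : Tendsto V atTop (𝓝 0)) {x : RMat n r} (hx : MapClusterPt x atTop X)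
    {ξ : RMat n r} (hξ : ξ ∈ stiefelTangent x) :
    h x ≤ inner ℝ (∇ f x) ξ + h (x + ξ) := by
  obtain ⟨φ, hφ, hXφ⟩ := hx.tendsto_subseq
  have hVφ := hV.comp hφ.tendsto_atTop
  have hgφ := (hf.tendsto x).comp hXφ
  -- Test the subproblems with the projections of `t • ξ` and pass to the limit. The quadratic term
  -- is of order `t²`, so it vanishes after division by `t` and `t → 0`.
  have key : ∀ t ∈ Set.Ioo (0 : ℝ) 1,
      h x ≤ inner ℝ (∇ f x) ξ + h (x + ξ) + 1 / 2 * κ₂ * t * ‖ξ‖ ^ 2 := by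
    intro t ht
    have hp : Tendsto (fun k => stiefelProj (X (φ k)) (t • ξ)) atTop (𝓝 (t • ξ)) := by
      have := ((continuous_stiefelProj (t • ξ)).tendsto x).comp hXφ
      rwa [stiefelProj_eq_self ((stiefelTangent x).smul_mem t hξ)] at this
    have hl : Tendsto (fun k => inner ℝ (∇ f (X (φ k))) (V (φ k)) + h (X (φ k) + V (φ k)))
        atTop (𝓝 (inner ℝ (∇ f x) 0 + h (x + 0))) :=
      (hgφ.inner hVφ).add ((hhc.tendsto _).comp (hXφ.add hVφ))
    have hr : Tendsto (fun k => inner ℝ (∇ f (X (φ k))) (stiefelProj (X (φ k)) (t • ξ))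
        + 1 / 2 * (κ₂ * ‖stiefelProj (X (φ k)) (t • ξ)‖ ^ 2)
        + h (X (φ k) + stiefelProj (X (φ k)) (t • ξ))) atTop
        (𝓝 (inner ℝ (∇ f x) (t • ξ) + 1 / 2 * (κ₂ * ‖t • ξ‖ ^ 2) + h (x + t • ξ))) :=
      ((hgφ.inner hp).add (((hp.norm.pow 2).const_mul κ₂).const_mul (1 / 2))).add
        ((hhc.tendsto _).comp (hXφ.add hp))
    have hle := le_of_tendsto_of_tendsto' hl hr fun k => by
      have h₁ := isMinOn_iff.1 (hX.direction_min (φ k)) _ (stiefelProj_mem (hmem (φ k)) (t • ξ))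
      have h₂ := hB₀ (φ k) _ (hX.direction_mem (φ k))
      have h₃ := hB (φ k) _ (stiefelProj_mem (hmem (φ k)) (t • ξ))
      simp only [subproblemObj] at h₁
      linarith
    have hc := hh.2 (Set.mem_univ x) (Set.mem_univ (x + ξ)) (sub_nonneg.2 ht.2.le) ht.1.le
      (sub_add_cancel _ _)
    rw [show (1 - t) • x + t • (x + ξ) = x + t • ξ by module, smul_eq_mul, smul_eq_mul] at hc
    rw [inner_zero_right, zero_add, add_zero, real_inner_smul_right, norm_smul,
      Real.norm_of_nonneg ht.1.le] at hle
    refine le_of_mul_le_mul_left ?_ ht.1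
    nlinarith
  have hlim : Tendsto (fun t : ℝ => inner ℝ (∇ f x) ξ + h (x + ξ) + 1 / 2 * κ₂ * t * ‖ξ‖ ^ 2)
      (𝓝[>] 0) (𝓝 (inner ℝ (∇ f x) ξ + h (x + ξ) + 1 / 2 * κ₂ * 0 * ‖ξ‖ ^ 2)) :=
    (Continuous.tendsto (by fun_prop) 0).mono_left nhdsWithin_le_nhds
  have h' := ge_of_tendsto hlim
    (by filter_upwards [Ioo_mem_nhdsGT (zero_lt_one' ℝ)] with t ht using key t ht)
  simpa using h'

end IsManPQNSequence

/-- A stationary point at which the Hessian of the pullback is sufficiently positive is a strict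
local minimizer of `f + h` on the Stiefel manifold. -/
theorem eventually_objective_lt_of_stationary {R : RMat n r → RMat n r → RMat n r}
    (hR : IsStiefelRetraction R) {M₂ : ℝ} {x : RMat n r} (hx : x ∈ stiefel n r)
    (hRM₂ : ∀ ξ ∈ stiefelTangent x, ‖R x ξ - x - ξ‖ ≤ M₂ * ‖ξ‖ ^ 2)
    {f h : RMat n r → ℝ} {Lh : ℝ≥0} (hf : ContDiff ℝ 2 f) (hhL : LipschitzWith Lh h)
    (hstat : ∀ ξ ∈ stiefelTangent x, h x ≤ inner ℝ (∇ f x) ξ + h (x + ξ)) {η : ℝ}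
    (hη : 2 * (Lh : ℝ) * M₂ < η)
    (hHess : LambdaMinGE
      (hessian (pullback R f x) 0 : stiefelTangent x →ₗ[ℝ] stiefelTangent x) η) :
    ∀ᶠ y in 𝓝 x, y ∈ stiefel n r → y ≠ x → f x + h x < f y + h y := by
  obtain ⟨c, hc₁, hc₂⟩ := exists_between hη
  have hg : ContDiff ℝ 2 (pullback R f x) :=
    hf.comp (contDiff_infty.1 (hR.contDiff hx) 2)
  have hzero : R x (0 : stiefelTangent x) = x := hR.map_zero x hx
  have hfd : ∀ ξ : stiefelTangent x, fderiv ℝ (pullback R f x) 0 ξ = inner ℝ (∇ f x) ξ := by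
    intro ξ
    have h₁ : HasFDerivAt f (fderiv ℝ f x) (R x (0 : stiefelTangent x)) := by
      rw [hzero]
      exact (hf.differentiable (by norm_num) x).hasFDerivAt
    have h₂ := h₁.comp (0 : stiefelTangent x) (hR.hasFDerivAt_zero x hx)
    rw [inner_gradient_left]
    exact congrArg (fun T : stiefelTangent x →L[ℝ] ℝ => T ξ) h₂.fderiv
  filter_upwards [hR.eventually_exists_eq hx (eventually_quadratic_growth hg hHess hc₂)]
    with y hy hys hyx
  obtain ⟨ξ, hξ, rfl⟩ := hy hys
  have hξ₀ : 0 < ‖ξ‖ := by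
    rw [norm_pos_iff]
    rintro rfl
    exact hyx hzero
  have h₁ : f x + inner ℝ (∇ f x) (ξ : RMat n r) + c / 2 * ‖ξ‖ ^ 2 ≤ f (R x ξ) := by
    have : pullback R f x 0 + fderiv ℝ (pullback R f x) 0 ξ + c / 2 * ‖ξ‖ ^ 2
        ≤ pullback R f x ξ := hξ
    rw [hfd] at this
    simpa only [pullback, hzero] using this
  have h₂ := (abs_le.1 (hhL.abs_sub_le (R x ξ) (x + ξ))).1
  rw [← sub_sub] at h₂
  have h₃ := mul_le_mul_of_nonneg_left (hRM₂ ξ ξ.2) Lh.coe_nonneg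
  have h₄ := hstat ξ ξ.2
  have h₅ : ‖(ξ : RMat n r)‖ = ‖ξ‖ := rfl
  rw [h₅] at h₃
  nlinarith [pow_pos hξ₀ 2]

end Iteration

theorem theorem4p2 (n r : ℕ)
    (R : RMat n r → RMat n r → RMat n r) (hR : IsStiefelRetraction R)
    (M₂ : ℝ) (hM₂ : 0 < M₂)
    (hRM₂ : ∀ X ∈ stiefel n r, ∀ ξ ∈ stiefelTangent X, ‖R X ξ - X - ξ‖ ≤ M₂ * ‖ξ‖ ^ 2)
    (f h : RMat n r → ℝ) (L Lh : ℝ≥0)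
    (hf : ContDiff ℝ 2 f) (hfL : LipschitzWith L (∇ f))
    (hh : ConvexOn ℝ Set.univ h) (hhL : LipschitzWith Lh h)
    (m : ℕ) (hm : 0 < m) (σ γ : ℝ) (hσ : σ ∈ Set.Ioo (0 : ℝ) 1) (hγ : γ ∈ Set.Ioo (0 : ℝ) 1)
    (X V : ℕ → RMat n r) (B : ℕ → RMat n r →ₗ[ℝ] RMat n r) (N : ℕ → ℕ)
    (hX : IsManPQNSequence R f h m σ γ X V B N)
    (κ₁ κ₂ : ℝ) (hκ₁ : 0 < κ₁)
    (hB : ∀ k, ∀ U ∈ stiefelTangent (X k),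
      κ₁ * ‖U‖ ^ 2 ≤ sqNorm (B k) U ∧ sqNorm (B k) U ≤ κ₂ * ‖U‖ ^ 2)
    (Xstar : RMat n r) (hXstar : MapClusterPt Xstar atTop X)
    (η : ℝ) (hη : 5 * (Lh : ℝ) * M₂ < η)
    (hHess : LambdaMinGE
      (hessian (pullback R f Xstar) 0 : stiefelTangent Xstar →ₗ[ℝ] stiefelTangent Xstar) η) :
    Tendsto X atTop (𝓝 Xstar) := by
  have hmem := hX.mem_stiefel hR
  have hfd : Differentiable ℝ f := hf.differentiable (by norm_num)
  obtain ⟨⟨w, hw⟩, hV, hstep⟩ := hX.asymptotics hR hM₂.le hRM₂ hfd hfL hh hhL hσ hγ hκ₁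
    fun k U hU => (hB k U hU).1
  have hmemstar : Xstar ∈ stiefel n r := by
    obtain ⟨φ, -, hφ⟩ := hXstar.tendsto_subseq
    exact (isCompact_stiefel n r).isClosed.mem_of_tendsto hφ (Eventually.of_forall fun k => hmem _)
  refine tendsto_of_mapClusterPt_of_strict_min (isCompact_stiefel n r)
    (hfd.continuous.add hhL.continuous) hmem hstep hw hXstar ?_
  refine eventually_objective_lt_of_stationary hR hmemstar (hRM₂ _ hmemstar) hf hhL ?_ ?_ hHess
  · exact fun ξ hξ => hX.stationary_of_mapClusterPt hmem hfL.continuous hh hhL.continuous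
      (fun k U hU => le_trans (by positivity) (hB k U hU).1) (fun k U hU => (hB k U hU).2)
      hV hXstar hξ
  -- The factor `5` leaves slack: strict minimality needs only `2`.
  · have : 0 ≤ (Lh : ℝ) * M₂ := by positivity
    linarith
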